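/- Let $d\in\mathbb N$, let $B_d$ be the open unit ball of $\mathbb C^d$, and let $\mathcal H^2_d$ be the Drury–Arveson space, i.e. the reproducing kernel Hilbert space on $B_d$ with kernel $k(x,y)=\frac{1}{1-\langle x,y\rangle}$ and kernel functions $k_y=k(\cdot,y)$. A set $V\subseteq B_d$ is called a variety if $V=\{x\in B_d: f(x)=0 \text{ for all } f\in F\}$ for some non-empty $F\subseteq\mathcal H^2_d$. For a variety $V$ let $H_V=\overline{\operatorname{span}}\{k_x:x\in V\}\subseteq\mathcal H^2_d$, regarded, by restricting its elements to $V$, as a reproducing kernel Hilbert space of functions on $V$. A function $f:V\to\mathbb C$ is a multiplier of $H_V$ if $fg\in H_V$ for all $g\in H_V$; then $M_fg=fg$ is a bounded operator on $H_V$. For a tuple $F=(f_1,\dots,f_d)$ of multipliers of $H_V$, let $\|F\|_{\mathrm{Mult}(V)}$ be the operator norm of the row operator $M_F:\bigoplus_{i=1}^d H_V\to H_V$, $M_F(g_1,\dots,g_d)=\sum_{i=1}^d f_ig_i$. **Theorem.** Let $V\subseteq B_d$ be a variety that contains at least two points, and let $Z=(Z_1,\dots,Z_d)$ be the tuple of coordinate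 functions on $B_d$. Then each $Z_i|_V$ is a multiplier of $H_V$, and $$\bigl\|Z|_V\bigr\|_{\mathrm{Mult}(V)}=1.$$ -/

import Mathlib

open scoped ComplexConjugate InnerProductSpace

noncomputable section

namespace DA

/-! ### Multipliers of a reproducing kernel Hilbert space of scalar functions -/

section Multipliers

variable {X : Type*} (H : Type*) [NormedAddCommGroup H] [InnerProductSpace ℂ H] [RKHS ℂ H X ℂ]

/-- `f` is a multiplier of `H`: the product `f * g` lies in `H` for every `g ∈ H`. -/
def IsMultiplier (f : X → ℂ) : Prop :=
  ∀ g : H, ∃ h : H, ∀ x, h x = f x * g x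

variable {H}

/-- The multiplication operator `g ↦ f * g` as a linear map. -/
def IsMultiplier.linearMap {f : X → ℂ} (hf : IsMultiplier H f) : H →ₗ[ℂ] H where
  toFun g := (hf g).choose
  map_add' g₁ g₂ := by
    refine RKHS.ext fun x => ?_
    have h := (hf (g₁ + g₂)).choose_spec x
    have h₁ := (hf g₁).choose_spec x
    have h₂ := (hf g₂).choose_spec x
    simp only [RKHS.coe_add, Pi.add_apply] at h ⊢
    rw [h, h₁, h₂, mul_add]
  map_smul' c g := by
    refine RKHS.ext fun x => ?_
    have h := (hf (c • g)).choose_spec x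
    have h₁ := (hf g).choose_spec x
    simp only [RKHS.coe_smul, Pi.smul_apply, smul_eq_mul, RingHom.id_apply] at h ⊢
    rw [h, h₁, mul_left_comm]

theorem IsMultiplier.linearMap_apply {f : X → ℂ} (hf : IsMultiplier H f) (g : H) (x : X) :
    hf.linearMap g x = f x * g x :=
  (hf g).choose_spec x

/-- The multiplication operator `M_f : H → H`, `M_f g = f * g`, which is automatically bounded. -/
def IsMultiplier.mulOp [CompleteSpace H] {f : X → ℂ} (hf : IsMultiplier H f) : H →L[ℂ] H :=
  ContinuousLinearMap.ofSeqClosedGraph (g := hf.linearMap) <| by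
    intro u g h hu hgu
    refine RKHS.ext fun x => ?_
    have h1 := ((RKHS.continuous_eval (H := H) x).tendsto h).comp hgu
    have h2 := (((RKHS.continuous_eval (H := H) x).tendsto g).comp hu).const_mul (f x)
    rw [hf.linearMap_apply]
    refine tendsto_nhds_unique h1 (h2.congr fun n => ?_)
    simp [hf.linearMap_apply]

@[simp]
theorem IsMultiplier.mulOp_apply [CompleteSpace H] {f : X → ℂ} (hf : IsMultiplier H f)
    (g : H) (x : X) : hf.mulOp g x = f x * g x :=
  hf.linearMap_apply g x

/-- The row operator `M_F : ⨁ᵢ H → H`, `M_F (g₁, …, g_d) = ∑ᵢ fᵢ gᵢ`, of a tuple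
`F = (f₁, …, f_d)` of multipliers, on the Hilbert space direct sum of `d` copies of `H`. -/
def rowOp [CompleteSpace H] {d : ℕ} {F : Fin d → X → ℂ} (hF : ∀ i, IsMultiplier H (F i)) :
    PiLp 2 (fun _ : Fin d => H) →L[ℂ] H :=
  ∑ i, (hF i).mulOp ∘L PiLp.proj 2 (fun _ : Fin d => H) i

theorem rowOp_apply [CompleteSpace H] {d : ℕ} {F : Fin d → X → ℂ}
    (hF : ∀ i, IsMultiplier H (F i)) (g : PiLp 2 (fun _ : Fin d => H)) :
    rowOp hF g = ∑ i, (hF i).mulOp (g i) := by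
  simp [rowOp]

/-- The multiplier norm of the vector valued multiplier `F`: the norm of its row operator. -/
def multNorm [CompleteSpace H] {d : ℕ} (F : Fin d → X → ℂ) (hF : ∀ i, IsMultiplier H (F i)) : ℝ :=
  ‖rowOp hF‖

end Multipliers

/-! ### The Drury–Arveson space -/

/-- The open unit ball of `ℂ^d`. -/
abbrev Ball (d : ℕ) : Type :=
  Metric.ball (0 : EuclideanSpace ℂ (Fin d)) 1

/-- The kernel `k(x, y) = 1 / (1 - ⟨x, y⟩)`, where `⟨x, y⟩ = ∑ᵢ xᵢ * conj yᵢ` (Mathlib's inner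
product is conjugate-linear in its first argument). -/
def ker {d : ℕ} (x y : Ball d) : ℂ :=
  1 / (1 - ⟪(y : EuclideanSpace ℂ (Fin d)), (x : EuclideanSpace ℂ (Fin d))⟫_ℂ)

/-- The kernel `k` as an operator valued matrix: `k(x, y)` acts on `ℂ` by multiplication. -/
def kerMatrix (d : ℕ) : Matrix (Ball d) (Ball d) (ℂ →L[ℂ] ℂ) :=
  Matrix.of fun x y => ker x y • ContinuousLinearMap.id ℂ ℂ

theorem norm_inner_lt_one {d : ℕ} (x y : Ball d) :
    ‖⟪(y : EuclideanSpace ℂ (Fin d)), (x : EuclideanSpace ℂ (Fin d))⟫_ℂ‖ < 1 := by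
  have hx : ‖(x : EuclideanSpace ℂ (Fin d))‖ < 1 := mem_ball_zero_iff.mp x.2
  have hy : ‖(y : EuclideanSpace ℂ (Fin d))‖ < 1 := mem_ball_zero_iff.mp y.2
  refine (norm_inner_le_norm _ _).trans_lt ?_
  nlinarith [norm_nonneg (x : EuclideanSpace ℂ (Fin d)),
    norm_nonneg (y : EuclideanSpace ℂ (Fin d))]

theorem conj_ker {d : ℕ} (x y : Ball d) : conj (ker x y) = ker y x := by
  simp [ker]

theorem hasSum_ker {d : ℕ} (x y : Ball d) :
    HasSum (fun n : ℕ => ⟪(y : EuclideanSpace ℂ (Fin d)),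
      (x : EuclideanSpace ℂ (Fin d))⟫_ℂ ^ n) (ker x y) := by
  rw [ker, one_div]
  exact hasSum_geometric_of_norm_lt_one (norm_inner_lt_one x y)

theorem inner_pow_eq {d : ℕ} (x y : EuclideanSpace ℂ (Fin d)) (n : ℕ) :
    ⟪y, x⟫_ℂ ^ n = ∑ α : Fin n → Fin d, (∏ j, x (α j)) * conj (∏ j, y (α j)) := by
  rw [PiLp.inner_apply, Fintype.sum_pow]
  refine Finset.sum_congr rfl fun α _ => ?_
  simp [Finset.prod_mul_distrib]

theorem posSemidef_kerMatrix (d : ℕ) : (kerMatrix d).PosSemidef := by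
  have tfae : (kerMatrix d).PosSemidef ↔ (kerMatrix d).IsHermitian ∧ ∀ v : Ball d →₀ ℂ,
      0 ≤ RCLike.re (v.sum fun x w => v.sum fun x' w' => ⟪kerMatrix d x' x w, w'⟫_ℂ) :=
    RKHS.posSemidef_tfae.out 0 2
  refine tfae.mpr ⟨?_, fun v => ?_⟩
  · ext x y
    have h : star (ContinuousLinearMap.id ℂ ℂ) = ContinuousLinearMap.id ℂ ℂ := star_one _
    simp [kerMatrix, conj_ker, h]
  · have key : HasSum (fun n : ℕ => v.sum fun x w => v.sum fun x' w' =>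
        (conj w * w') * ⟪(x' : EuclideanSpace ℂ (Fin d)), (x : EuclideanSpace ℂ (Fin d))⟫_ℂ ^ n)
        (v.sum fun x w => v.sum fun x' w' => ⟪kerMatrix d x' x w, w'⟫_ℂ) := by
      refine hasSum_sum fun x _ => hasSum_sum fun x' _ => ?_
      have hk : ⟪kerMatrix d x' x (v x), v x'⟫_ℂ = (conj (v x) * v x') * ker x x' := by
        simp [kerMatrix, conj_ker]
        ring
      change HasSum _ ⟪kerMatrix d x' x (v x), v x'⟫_ℂ
      rw [hk]
      exact (hasSum_ker x x').mul_left _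
    have hre := Complex.hasSum_re key
    refine hre.nonneg fun n => ?_
    have : (v.sum fun x w => v.sum fun x' w' =>
        (conj w * w') * ⟪(x' : EuclideanSpace ℂ (Fin d)), (x : EuclideanSpace ℂ (Fin d))⟫_ℂ ^ n)
        = ∑ α : Fin n → Fin d, (v.sum fun x w => conj w * ∏ j, (x : EuclideanSpace ℂ (Fin d)) (α j))
          * conj (v.sum fun x w => conj w * ∏ j, (x : EuclideanSpace ℂ (Fin d)) (α j)) := by
      simp only [Finsupp.sum, inner_pow_eq, Finset.mul_sum, map_sum, Finset.sum_mul]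
      rw [Finset.sum_comm]
      simp_rw [Finset.sum_comm (s := v.support) (t := Finset.univ)]
      refine Finset.sum_congr rfl fun α _ => Finset.sum_congr rfl fun x' _ =>
        Finset.sum_congr rfl fun x _ => ?_
      simp only [map_mul, Complex.conj_conj]
      ring
    rw [this, Complex.re_sum]
    refine Finset.sum_nonneg fun α _ => ?_
    rw [Complex.mul_conj]
    exact Complex.normSq_nonneg _

instance (d : ℕ) : Fact (kerMatrix d).PosSemidef := ⟨posSemidef_kerMatrix d⟩

/-- The Drury–Arveson space `H²_d`: the reproducing kernel Hilbert space on the ball with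
kernel `k`. -/
abbrev Space (d : ℕ) : Type := RKHS.OfKernel (kerMatrix d)

/-- The kernel function `k_y ∈ H²_d`, for which `k_y(x) = k(x, y)`. -/
def kerFn {d : ℕ} (y : Ball d) : Space d := RKHS.kerFun (Space d) y 1

theorem kerFn_apply {d : ℕ} (x y : Ball d) : kerFn y x = ker x y := by
  rw [kerFn, RKHS.kerFun_apply, RKHS.OfKernel.kernel_ofKernel]
  simp [kerMatrix]

theorem inner_kerFn {d : ℕ} (f : Space d) (x : Ball d) : ⟪kerFn x, f⟫_ℂ = f x := by
  simp [kerFn]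

/-- `V` is a variety in the ball: the common zero set of a non-empty subset of `H²_d`. -/
def IsVariety {d : ℕ} (V : Set (Ball d)) : Prop :=
  ∃ F : Set (Space d), F.Nonempty ∧ V = {x | ∀ f ∈ F, f x = 0}

/-- The closed linear span `H_V` of the kernel functions `k_x`, `x ∈ V`, in `H²_d`. -/
def HV {d : ℕ} (V : Set (Ball d)) : Submodule ℂ (Space d) :=
  (Submodule.span ℂ (kerFn '' V)).topologicalClosure

theorem isClosed_HV {d : ℕ} (V : Set (Ball d)) : IsClosed (HV V : Set (Space d)) :=
  Submodule.isClosed_topologicalClosure _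

instance {d : ℕ} (V : Set (Ball d)) : CompleteSpace (HV V) :=
  (isClosed_HV V).completeSpace_coe

/-- `H_V` as a reproducing kernel Hilbert space on `V`: its elements are regarded as functions
on `V` by restriction, with the inner product of `H²_d`. -/
instance {d : ℕ} (V : Set (Ball d)) : RKHS ℂ (HV V) V ℂ where
  coeCLM := ContinuousLinearMap.pi fun x : V =>
    (ContinuousLinearMap.proj (R := ℂ) (φ := fun _ : Ball d => ℂ) x.1 ∘L
      RKHS.coeCLM ℂ (H := Space d)) ∘L (HV V).subtypeL
  coeCLM_injective := by
    refine (injective_iff_map_eq_zero _).mpr fun f hf => ?_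
    have hort : (f : Space d) ∈ (Submodule.span ℂ (kerFn '' V))ᗮ := by
      rw [Submodule.mem_orthogonal]
      intro u hu
      induction hu using Submodule.span_induction with
      | mem u hu =>
        obtain ⟨x, hx, rfl⟩ := hu
        rw [inner_kerFn]
        exact congrFun hf ⟨x, hx⟩
      | zero => simp
      | add u w _ _ hu hw => simp [inner_add_left, hu, hw]
      | smul c u _ hu => simp [inner_smul_left, hu]
    rw [← Submodule.orthogonal_closure] at hort
    have := Submodule.inner_right_of_mem_orthogonal f.2 hort
    exact Subtype.ext (inner_self_eq_zero.mp this)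

theorem HV_apply {d : ℕ} {V : Set (Ball d)} (f : HV V) (x : V) : f x = (f : Space d) x.1 :=
  rfl

/-- The tuple `Z = (Z₁, …, Z_d)` of coordinate functions, restricted to `V`. -/
def coordOn {d : ℕ} (V : Set (Ball d)) (i : Fin d) (x : V) : ℂ :=
  (x.1 : EuclideanSpace ℂ (Fin d)) i

end DA

end

/-!
The adjoint of the row operator `M_Z` on `H_V` acts on kernel functions by
`k_x ↦ (conj x_i • k_x)_i`. Since `⟨x, y⟩ k(x, y) = k(x, y) - 1`, this assignment satisfies
`‖M_Z^* f‖² = ‖f‖² - |∑ₓ cₓ|²` for a finite combination `f = ∑ₓ cₓ k_x` (`norm_sq_coordComb`);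
the number `∑ₓ cₓ` is the value of `f` at the origin of the ball. Hence the assignment extends by
density to a contraction `T : H_V → H_V^d` (`coordAdjoint`). The adjoint of `T` multiplies by the
coordinates, which shows both that the coordinates are multipliers and that `M_Z = T^*` has norm
at most one. If `x ≠ y` are points of `V`, then `f = k_x - k_y` is a non-zero element of `H_V`
which vanishes at the origin, so `‖T f‖ = ‖f‖` and the norm is exactly one.

The argument only uses the identity `(∑ᵢ zᵢ(x) conj zᵢ(y)) k(x, y) = k(x, y) - 1`, and is carried
out for an arbitrary reproducing kernel Hilbert space with functions `zᵢ` of this kind.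
-/

open scoped ComplexConjugate InnerProductSpace

noncomputable section

namespace DA

/-! ### Kernels of the form `1 / (1 - ∑ᵢ zᵢ(x) conj zᵢ(y))` -/

section General

variable {X : Type*} (H : Type*) [NormedAddCommGroup H] [InnerProductSpace ℂ H] [RKHS ℂ H X ℂ]
  [CompleteSpace H] {d : ℕ}

/-- The scalar kernel of `H` is `1 / (1 - ∑ᵢ zᵢ(x) conj zᵢ(y))`, in a form free of division. -/
def HasRowKernel (z : Fin d → X → ℂ) : Prop :=
  ∀ x y, ∑ i, z i x * (conj (z i y) * ⟪RKHS.kerFun H x (1 : ℂ), RKHS.kerFun H y (1 : ℂ)⟫_ℂ)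
    = ⟪RKHS.kerFun H x (1 : ℂ), RKHS.kerFun H y (1 : ℂ)⟫_ℂ - 1

/-- The finite linear combination `∑ₓ cₓ k_x` of kernel functions. -/
def kerComb : (X →₀ ℂ) →ₗ[ℂ] H :=
  Finsupp.linearCombination ℂ fun x => RKHS.kerFun H x (1 : ℂ)

/-- The tuple `(∑ₓ cₓ conj zᵢ(x) k_x)ᵢ`. -/
def coordComb (z : Fin d → X → ℂ) : (X →₀ ℂ) →ₗ[ℂ] PiLp 2 (fun _ : Fin d => H) :=
  Finsupp.linearCombination ℂ fun x =>
    WithLp.toLp 2 fun i => conj (z i x) • RKHS.kerFun H x (1 : ℂ)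

theorem kerComb_single (x : X) (a : ℂ) :
    kerComb H (Finsupp.single x a) = a • RKHS.kerFun H x (1 : ℂ) := by
  simp [kerComb]

theorem coordComb_single (z : Fin d → X → ℂ) (x : X) (a : ℂ) :
    coordComb H z (Finsupp.single x a)
      = a • WithLp.toLp 2 fun i => conj (z i x) • RKHS.kerFun H x (1 : ℂ) := by
  simp [coordComb]

theorem denseRange_kerComb : DenseRange (kerComb H : (X →₀ ℂ) → H) := by
  have hle : Submodule.span ℂ {RKHS.kerFun H x v | (x : X) (v : ℂ)}
      ≤ LinearMap.range (kerComb H : (X →₀ ℂ) →ₗ[ℂ] H) := by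
    refine Submodule.span_le.mpr ?_
    rintro _ ⟨x, v, rfl⟩
    refine ⟨Finsupp.single x v, ?_⟩
    rw [kerComb_single, ← map_smul, smul_eq_mul, mul_one]
  have htop := Submodule.topologicalClosure_mono hle
  rw [RKHS.kerFun_dense, top_le_iff] at htop
  exact Submodule.dense_iff_topologicalClosure_eq_top.mpr htop

theorem inner_kerFun_one (x : X) (f : H) : ⟪RKHS.kerFun H x (1 : ℂ), f⟫_ℂ = f x := by
  simp

variable {H} {z : Fin d → X → ℂ}

/-- The polarized form of `norm_sq_coordComb`. -/
theorem inner_coordComb (hz : HasRowKernel H z) (a b : X →₀ ℂ) :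
    ⟪coordComb H z a, coordComb H z b⟫_ℂ = ⟪kerComb H a, kerComb H b⟫_ℂ
      - conj (a.sum fun _ w => w) * b.sum fun _ w => w := by
  have hadd (u v : X →₀ ℂ) : ((u + v).sum fun _ w => w)
      = (u.sum fun _ w => w) + v.sum fun _ w => w :=
    Finsupp.sum_add_index' (fun _ => rfl) fun _ _ _ => rfl
  induction a using Finsupp.induction_linear with
  | zero => simp
  | add u v hu hv =>
    rw [map_add, map_add, inner_add_left, inner_add_left, hadd, hu, hv, map_add]
    ring
  | single x s =>
    induction b using Finsupp.induction_linear with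
    | zero => simp
    | add u v hu hv =>
      rw [map_add, map_add, inner_add_right, inner_add_right, hadd, hu, hv]
      ring
    | single y t =>
      have hterm : ⟪WithLp.toLp 2 fun i => conj (z i x) • RKHS.kerFun H x (1 : ℂ),
          WithLp.toLp 2 fun i => conj (z i y) • RKHS.kerFun H y (1 : ℂ)⟫_ℂ
          = ⟪RKHS.kerFun H x (1 : ℂ), RKHS.kerFun H y (1 : ℂ)⟫_ℂ - 1 := by
        rw [PiLp.inner_apply, ← hz]
        refine Finset.sum_congr rfl fun i _ => ?_
        rw [inner_smul_left, inner_smul_right, Complex.conj_conj]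
      rw [coordComb_single, coordComb_single, kerComb_single, kerComb_single, inner_smul_left,
        inner_smul_right, inner_smul_left, inner_smul_right, hterm,
        Finsupp.sum_single_index rfl, Finsupp.sum_single_index rfl]
      ring

theorem norm_sq_coordComb (hz : HasRowKernel H z) (c : X →₀ ℂ) :
    ‖coordComb H z c‖ ^ 2 = ‖kerComb H c‖ ^ 2 - ‖c.sum fun _ w => w‖ ^ 2 := by
  have h := inner_coordComb hz c c
  rw [inner_self_eq_norm_sq_to_K, inner_self_eq_norm_sq_to_K, Complex.conj_mul'] at h
  refine Complex.ofReal_injective ?_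
  push_cast
  exact h

theorem norm_coordComb_le (hz : HasRowKernel H z) (c : X →₀ ℂ) :
    ‖coordComb H z c‖ ≤ 1 * ‖kerComb H c‖ := by
  rw [one_mul]
  refine (sq_le_sq₀ (norm_nonneg _) (norm_nonneg _)).mp ?_
  rw [norm_sq_coordComb hz]
  exact sub_le_self _ (sq_nonneg _)

variable (H z) in
/-- The continuous extension `H → H^d` of `k_x ↦ (conj zᵢ(x) k_x)ᵢ` from the span of the kernel
functions. It is a contraction with this property if `HasRowKernel H z`, and has no meaning
otherwise. -/
def coordAdjoint : H →L[ℂ] PiLp 2 (fun _ : Fin d => H) :=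
  (coordComb H z).extendOfNorm (kerComb H)

theorem coordAdjoint_kerComb (hz : HasRowKernel H z) (c : X →₀ ℂ) :
    coordAdjoint H z (kerComb H c) = coordComb H z c :=
  LinearMap.extendOfNorm_eq (denseRange_kerComb H) ⟨1, norm_coordComb_le hz⟩ c

theorem norm_coordAdjoint_le (hz : HasRowKernel H z) : ‖coordAdjoint H z‖ ≤ 1 :=
  LinearMap.opNorm_extendOfNorm_le (denseRange_kerComb H) zero_le_one (norm_coordComb_le hz)

theorem adjoint_coordAdjoint_apply (hz : HasRowKernel H z) (g : PiLp 2 (fun _ : Fin d => H))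
    (x : X) : (coordAdjoint H z).adjoint g x = ∑ i, z i x * g i x := by
  have hx : coordAdjoint H z (RKHS.kerFun H x (1 : ℂ))
      = WithLp.toLp 2 fun i => conj (z i x) • RKHS.kerFun H x (1 : ℂ) := by
    have h := coordAdjoint_kerComb hz (Finsupp.single x (1 : ℂ))
    rwa [kerComb_single, coordComb_single, one_smul, one_smul] at h
  rw [← inner_kerFun_one, ContinuousLinearMap.adjoint_inner_right, hx, PiLp.inner_apply]
  refine Finset.sum_congr rfl fun i _ => ?_
  rw [inner_smul_left, inner_kerFun_one, Complex.conj_conj]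

theorem HasRowKernel.isMultiplier (hz : HasRowKernel H z) (i : Fin d) :
    IsMultiplier H (z i) := by
  intro g
  refine ⟨(coordAdjoint H z).adjoint (WithLp.toLp 2 (Pi.single i g)), fun x => ?_⟩
  rw [adjoint_coordAdjoint_apply hz, Finset.sum_eq_single i]
  · simp
  · intro j _ hj
    simp [hj, RKHS.coe_zero]
  · simp

theorem rowOp_eq_adjoint (hz : HasRowKernel H z) (hm : ∀ i, IsMultiplier H (z i)) :
    rowOp hm = (coordAdjoint H z).adjoint := by
  ext1 g
  refine RKHS.ext fun x => ?_
  rw [adjoint_coordAdjoint_apply hz, rowOp_apply, ← inner_kerFun_one, inner_sum]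
  refine Finset.sum_congr rfl fun i _ => ?_
  rw [inner_kerFun_one, IsMultiplier.mulOp_apply]

/-- The adjoint row operator is isometric on `k_x - k_y`. -/
theorem one_le_norm_coordAdjoint (hz : HasRowKernel H z) {x y : X}
    (hxy : RKHS.kerFun H x (1 : ℂ) ≠ RKHS.kerFun H y (1 : ℂ)) : 1 ≤ ‖coordAdjoint H z‖ := by
  let c : X →₀ ℂ := Finsupp.single x 1 - Finsupp.single y 1
  have hsum : (c.sum fun _ w => w) = 0 := by
    rw [Finsupp.sum_sub_index fun _ _ _ => rfl, Finsupp.sum_single_index rfl,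
      Finsupp.sum_single_index rfl, sub_self]
  have hne : kerComb H c ≠ 0 := by
    intro h
    rw [map_sub, kerComb_single, kerComb_single, one_smul, one_smul, sub_eq_zero] at h
    exact hxy h
  have hnorm : ‖coordAdjoint H z (kerComb H c)‖ = ‖kerComb H c‖ := by
    refine (sq_eq_sq₀ (norm_nonneg _) (norm_nonneg _)).mp ?_
    rw [coordAdjoint_kerComb hz, norm_sq_coordComb hz, hsum]
    simp
  have hle := (coordAdjoint H z).le_opNorm (kerComb H c)
  rw [hnorm] at hle
  exact (le_mul_iff_one_le_left (norm_pos_iff.mpr hne)).mp hle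

theorem multNorm_eq_one (hz : HasRowKernel H z) {x y : X}
    (hxy : RKHS.kerFun H x (1 : ℂ) ≠ RKHS.kerFun H y (1 : ℂ)) (hm : ∀ i, IsMultiplier H (z i)) :
    multNorm z hm = 1 := by
  rw [multNorm, rowOp_eq_adjoint hz, LinearIsometryEquiv.norm_map]
  exact le_antisymm (norm_coordAdjoint_le hz) (one_le_norm_coordAdjoint hz hxy)

end General

/-! ### The kernel functions of `H_V` -/

variable {d : ℕ} {V : Set (Ball d)}

theorem inner_mul_ker (x y : Ball d) :
    ⟪(y : EuclideanSpace ℂ (Fin d)), (x : EuclideanSpace ℂ (Fin d))⟫_ℂ * ker x y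
      = ker x y - 1 := by
  have h : 1 - ⟪(y : EuclideanSpace ℂ (Fin d)), (x : EuclideanSpace ℂ (Fin d))⟫_ℂ ≠ 0 := by
    intro h
    have h' := norm_inner_lt_one x y
    rw [← sub_eq_zero.mp h, norm_one] at h'
    exact lt_irrefl _ h'
  rw [ker]
  field_simp
  ring

theorem kerFn_injective : Function.Injective (kerFn : Ball d → Space d) := by
  intro x y h
  have hk (z : Ball d) : ⟪(x : EuclideanSpace ℂ (Fin d)), (z : EuclideanSpace ℂ (Fin d))⟫_ℂ
      = ⟪(y : EuclideanSpace ℂ (Fin d)), (z : EuclideanSpace ℂ (Fin d))⟫_ℂ := by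
    have hz : ker z x = ker z y := by rw [← kerFn_apply, ← kerFn_apply, h]
    simpa [ker] using hz
  refine Subtype.ext (sub_eq_zero.mp (inner_self_eq_zero (𝕜 := ℂ).mp ?_))
  rw [inner_sub_left, inner_sub_right, inner_sub_right, hk x, hk y]
  simp

/-- The kernel function of `H_V` at `x ∈ V` is the kernel function `k_x` of the whole space,
which lies in `H_V`. -/
theorem coe_kerFun_HV (x : V) : (RKHS.kerFun (HV V) x (1 : ℂ) : Space d) = kerFn x.1 := by
  let k : HV V :=
    ⟨kerFn x.1, Submodule.le_topologicalClosure _ (Submodule.subset_span ⟨x.1, x.2, rfl⟩)⟩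
  have h : RKHS.kerFun (HV V) x (1 : ℂ) = k := by
    refine ext_inner_right ℂ fun f => ?_
    rw [inner_kerFun_one]
    exact (inner_kerFn (f : Space d) x.1).symm
  exact congrArg Subtype.val h

theorem inner_kerFun_HV (x y : V) :
    ⟪RKHS.kerFun (HV V) x (1 : ℂ), RKHS.kerFun (HV V) y (1 : ℂ)⟫_ℂ = ker x.1 y.1 := by
  rw [inner_kerFun_one, HV_apply, coe_kerFun_HV, kerFn_apply]

theorem hasRowKernel_HV : HasRowKernel (HV V) (coordOn V) := by
  intro x y
  rw [inner_kerFun_HV, ← inner_mul_ker, PiLp.inner_apply, Finset.sum_mul]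
  refine Finset.sum_congr rfl fun i _ => ?_
  simp only [coordOn, RCLike.inner_apply]
  ring

end DA

end

theorem mainTheorem7 (d : ℕ) (V : Set (DA.Ball d)) (hV : DA.IsVariety V) (h2 : V.Nontrivial) :
    ∃ hZ : ∀ i, DA.IsMultiplier (DA.HV V) (DA.coordOn V i),
      DA.multNorm (DA.coordOn V) hZ = 1 := by
  obtain ⟨x, hx, y, hy, hxy⟩ := h2
  refine ⟨DA.hasRowKernel_HV.isMultiplier,
    DA.multNorm_eq_one DA.hasRowKernel_HV (x := ⟨x, hx⟩) (y := ⟨y, hy⟩) (fun h => hxy ?_) _⟩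
  have hcoe := congrArg Subtype.val h
  rw [DA.coe_kerFun_HV, DA.coe_kerFun_HV] at hcoe
  exact DA.kerFn_injective hcoe
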